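/- Throughout, the sums over $j$ run over all integers $j$, and $\binom{m}{k}=0$ unless $0\le k\le m$, so that each sum has only finitely many nonzero terms. **Theorem.** For every $n\ge 0$ the Laurent polynomials in the indeterminate $q$ $$C_{2n}(q)=\sum_{j\in\mathbb Z}\left[\binom{2n}{n-3j}-\binom{2n}{n-3j-1}\right]q^{\,n^2-3j^2-j},$$ $$C_{2n+1}(q)=\sum_{j\in\mathbb Z}\left[\binom{2n+1}{n-3j}-\binom{2n+1}{n-3j-1}\right]q^{\,n^2+n-3j^2-2j}$$ are polynomials with integer coefficients. For every finite field $GF(q)$ with $q$ elements and every $N\ge 0$, the number of $N\times N$ upper-triangular matrices over $GF(q)$ whose square is the zero matrix equals the value at $q$ of the polynomial $C_N$. -/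

import Mathlib

open scoped Polynomial LaurentPolynomial

/-- The binomial coefficient with a natural upper and an integer lower index; it is `0`
unless `0 ≤ k ≤ m`. -/
def binomZ (m : ℕ) (k : ℤ) : ℤ :=
  if 0 ≤ k then (m.choose k.toNat : ℤ) else 0

theorem binomZ_of_neg {m : ℕ} {k : ℤ} (hk : k < 0) : binomZ m k = 0 := by
  simp [binomZ, not_le.mpr hk]

theorem binomZ_of_lt {m : ℕ} {k : ℤ} (hk : (m : ℤ) < k) : binomZ m k = 0 := by
  unfold binomZ
  rw [if_pos (by omega), Nat.choose_eq_zero_of_lt (by omega)]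
  rfl

/-- The coefficient `binom(m, k - 3j) - binom(m, k - 3j - 1)`. -/
def coeffKM (m : ℕ) (k j : ℤ) : ℤ :=
  binomZ m (k - 3 * j) - binomZ m (k - 3 * j - 1)

/-- Only finitely many integers `j` contribute, so the sums over all of `ℤ` below are
genuine finite sums. -/
theorem finite_support_coeffKM (m : ℕ) (k : ℤ) (e : ℤ → ℤ) :
    (Function.support fun j : ℤ =>
      LaurentPolynomial.C (coeffKM m k j) * LaurentPolynomial.T (e j)).Finite := by
  refine (Set.finite_Icc (-(m : ℤ) - |k| - 1) (|k| + 1)).subset fun j hj => ?_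
  by_contra h
  apply hj
  have hk := le_abs_self k
  have hk' := neg_abs_le k
  have h0 : coeffKM m k j = 0 := by
    unfold coeffKM
    rcases lt_or_ge j (-(m : ℤ) - |k| - 1) with h1 | h1
    · rw [binomZ_of_lt (by omega), binomZ_of_lt (by omega), sub_zero]
    · have h2 : |k| + 1 < j := by
        by_contra h3
        exact h ⟨h1, not_lt.mp h3⟩
      rw [binomZ_of_neg (by omega), binomZ_of_neg (by omega), sub_zero]
  simp [h0]

/-- The right-hand side for size `2 * n`, a sum over all integers `j`, where `T e` is
the power `q ^ e` of the indeterminate with an integer exponent. -/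
noncomputable def evenSum (n : ℕ) : ℤ[T;T⁻¹] :=
  ∑ᶠ j : ℤ, LaurentPolynomial.C (coeffKM (2 * n) n j) *
    LaurentPolynomial.T ((n : ℤ) ^ 2 - 3 * j ^ 2 - j)

/-- The right-hand side for size `2 * n + 1`. -/
noncomputable def oddSum (n : ℕ) : ℤ[T;T⁻¹] :=
  ∑ᶠ j : ℤ, LaurentPolynomial.C (coeffKM (2 * n + 1) n j) *
    LaurentPolynomial.T ((n : ℤ) ^ 2 + n - 3 * j ^ 2 - 2 * j)

/-- The number of upper-triangular `N × N` matrices over `F` (the entries below the diagonal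
vanish, the diagonal is unrestricted) whose square is zero. -/
noncomputable def numSquareZero (F : Type*) [Field F] (N : ℕ) : ℕ :=
  Nat.card {A : Matrix (Fin N) (Fin N) F // A.IsUpperTriangular ∧ A ^ 2 = 0}

/-! An upper-triangular square-zero matrix of size `N + 1` is one, `A`, of size `N` bordered by a
top row `w` with `w A = 0`. If `A` has rank `r`, its row space (dimension `r`) lies in its left
kernel (dimension `N - r`), so `q^r` choices of `w` keep the rank and `q^(N-r) - q^r` raise it by
one. Iteration gives a linear functional on functions of the rank, `rankFunctional`, whose value at
`1` is the count (`sum_rank_squareZeroUT`).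

This functional sends `r ↦ q^(-r(N-r)) [N-2r, i-r]`, a Gaussian binomial in `q⁻¹`, to the ordinary
`binom(N, i)` (`rankFunctional_gaussBinom`). By linearity each closed form is the functional applied
to the same signed sum of Gaussian binomials. Finite pentagonal identities (`pentagonalEven_eq`,
`pentagonalOdd_eq_T`) collapse that sum to one power of `q`, which cancels the prefactor and leaves
the function `1`. -/

open LaurentPolynomial (T T_add T_zero)

/-! ### Gaussian binomial coefficients in the variable `q⁻¹` -/

/-- The Gaussian binomial coefficient in the variable `T (-1)`, with an integer lower index. -/
noncomputable def gaussBinom : ℕ → ℤ → ℤ[T;T⁻¹]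
  | 0, k => if k = 0 then 1 else 0
  | N + 1, k => T (-k) * gaussBinom N k + gaussBinom N (k - 1)

theorem gaussBinom_succ (N : ℕ) (k : ℤ) :
    gaussBinom (N + 1) k = T (-k) * gaussBinom N k + gaussBinom N (k - 1) := rfl

theorem gaussBinom_succ' (N : ℕ) (k : ℤ) :
    gaussBinom (N + 1) k = gaussBinom N k + T (k - N - 1) * gaussBinom N (k - 1) := by
  induction N generalizing k with
  | zero =>
    rcases eq_or_ne k 0 with rfl | h0
    · simp [gaussBinom]
    · rcases eq_or_ne k 1 with rfl | h1
      · simp [gaussBinom]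
      · simp [gaussBinom, h0, sub_eq_zero, h1]
  | succ N ih =>
    rw [gaussBinom_succ (N + 1) k]
    have e := ih (k - 1)
    have h : (T (-k) * T (k - N - 1) : ℤ[T;T⁻¹]) =
        T (k - (N + 1 : ℕ) - 1) * T (-(k - 1)) := by
      rw [← T_add, ← T_add]; congr 1; push_cast; ring
    have h' : (T (k - 1 - N - 1) : ℤ[T;T⁻¹]) = T (k - (N + 1 : ℕ) - 1) := by
      congr 1; push_cast; ring
    rw [h'] at e
    linear_combination T (-k) * ih k + e - gaussBinom_succ N k -
      T (k - (N + 1 : ℕ) - 1) * gaussBinom_succ N (k - 1) + gaussBinom N (k - 1) * h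

theorem gaussBinom_of_notMem (N : ℕ) (k : ℤ) (hk : k ∉ Set.Icc (0 : ℤ) N) :
    gaussBinom N k = 0 := by
  induction N generalizing k with
  | zero =>
    have : k ≠ 0 := by rintro rfl; simp at hk
    simp [gaussBinom, this]
  | succ N ih =>
    simp only [Set.mem_Icc, not_and_or, not_le] at hk ih
    rw [gaussBinom_succ, ih k (by push_cast at hk; omega), ih (k - 1) (by push_cast at hk; omega)]
    simp

theorem gaussBinom_symm (N : ℕ) (k : ℤ) : gaussBinom N (N - k) = gaussBinom N k := by
  induction N generalizing k with
  | zero => simp [gaussBinom]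
  | succ N ih =>
    rw [gaussBinom_succ' N k, gaussBinom_succ, ← ih k, ← ih (k - 1)]
    have h1 : (((N + 1 : ℕ) : ℤ) - k) = N - (k - 1) := by push_cast; ring
    have h2 : (N : ℤ) - (k - 1) - 1 = N - k := by ring
    have h3 : -((N : ℤ) - (k - 1)) = k - N - 1 := by ring
    rw [h1, h2, h3, add_comm]

/-- Elimination between the two Pascal rules. The factor `1 - q^(-(s+1))` is the normalized form of
the weight `q^(N-r) - q^r` in `rankFunctional`, with `s + 1 = N - 2r`. -/
theorem gaussBinom_three_term (s : ℕ) (k : ℤ) :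
    gaussBinom (s + 2) k + (1 - T (-((s : ℤ) + 1))) * gaussBinom s (k - 1) =
      gaussBinom (s + 1) k + gaussBinom (s + 1) (k - 1) := by
  rw [gaussBinom_succ' (s + 1) k]
  have e1 := gaussBinom_succ s (k - 1)
  have e2 := gaussBinom_succ' s (k - 1)
  have h : (T (k - (s + 1 : ℕ) - 1) * T (-(k - 1)) : ℤ[T;T⁻¹]) = T (-((s : ℤ) + 1)) := by
    rw [← T_add]; congr 1; push_cast; ring
  have h' : (T (k - 1 - s - 1) : ℤ[T;T⁻¹]) = T (k - (s + 1 : ℕ) - 1) := by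
    congr 1; push_cast; ring
  rw [h'] at e2
  linear_combination T (k - (s + 1 : ℕ) - 1) * e1 - e2 + h * gaussBinom s (k - 1)

theorem finite_support_mul_gaussBinom (c : ℤ → ℤ[T;T⁻¹]) (N : ℕ) {κ : ℤ → ℤ}
    (hκ : Function.Injective κ) :
    (Function.support fun j => c j * gaussBinom N (κ j)).Finite := by
  refine ((Set.finite_Icc (0 : ℤ) N).preimage hκ.injOn).subset fun j hj => ?_
  by_contra h
  exact hj (by simp [gaussBinom_of_notMem N (κ j) h])

theorem finsum_sub_reindex {ι M : Type*} [AddCommGroup M] {f g : ι → M}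
    (hf : f.support.Finite) (hg : g.support.Finite) (e₁ e₂ : ι ≃ ι) :
    ∑ᶠ j, (f j - g j) = ∑ᶠ j, (f (e₁ j) - g (e₂ j)) := by
  have hf' : (Function.support fun j => f (e₁ j)).Finite := hf.preimage e₁.injective.injOn
  have hg' : (Function.support fun j => g (e₂ j)).Finite := hg.preimage e₂.injective.injOn
  rw [finsum_sub_distrib hf hg, finsum_sub_distrib hf' hg', finsum_comp_equiv e₁,
    finsum_comp_equiv e₂]

/-! ### Two finite forms of the pentagonal number theorem -/

/-- The alternating sum of Gaussian binomial coefficients for an even upper index. -/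
noncomputable def pentagonalEven (t : ℕ) : ℤ[T;T⁻¹] :=
  ∑ᶠ j : ℤ, T (-(3 * j ^ 2 + j)) *
    (gaussBinom (2 * t) (t - 3 * j) - gaussBinom (2 * t) (t - 3 * j - 1))

/-- The alternating sum of Gaussian binomial coefficients for an odd upper index. -/
noncomputable def pentagonalOdd (t : ℕ) : ℤ[T;T⁻¹] :=
  ∑ᶠ j : ℤ, T (-(3 * j ^ 2 + 2 * j)) *
    (gaussBinom (2 * t + 1) (t - 3 * j) - gaussBinom (2 * t + 1) (t - 3 * j - 1))

/-- Different Pascal rules are applied to the two binomials, so that the common middle term cancels.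
The substitutions `j ↦ -j` and `j ↦ -1 - j`, followed by symmetry, turn the remainder into the even
sum. -/
theorem pentagonalOdd_eq (t : ℕ) : pentagonalOdd t = T (-(t : ℤ)) * pentagonalEven t := by
  unfold pentagonalOdd pentagonalEven
  have hsplit : ∀ j : ℤ, T (-(3 * j ^ 2 + 2 * j)) *
      (gaussBinom (2 * t + 1) (t - 3 * j) - gaussBinom (2 * t + 1) (t - 3 * j - 1)) =
      T (-(3 * j ^ 2 - j + t)) * gaussBinom (2 * t) (t - 3 * j) -
      T (-(3 * j ^ 2 + 5 * j + 2 + t)) * gaussBinom (2 * t) (t - 3 * j - 2) := by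
    intro j
    rw [gaussBinom_succ (2 * t) (t - 3 * j), gaussBinom_succ' (2 * t) (t - 3 * j - 1)]
    have h1 : (T (-(3 * j ^ 2 - j + t)) : ℤ[T;T⁻¹]) =
        T (-(3 * j ^ 2 + 2 * j)) * T (-(t - 3 * j)) := by
      rw [← T_add]; congr 1; ring
    have h2 : (T (-(3 * j ^ 2 + 5 * j + 2 + t)) : ℤ[T;T⁻¹]) =
        T (-(3 * j ^ 2 + 2 * j)) * T ((t : ℤ) - 3 * j - 1 - (2 * t : ℕ) - 1) := by
      rw [← T_add]; congr 1; push_cast; ring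
    have h3 : (t : ℤ) - 3 * j - 1 - 1 = t - 3 * j - 2 := by ring
    rw [h1, h2, h3]
    ring
  rw [finsum_congr hsplit, finsum_sub_reindex
    (finite_support_mul_gaussBinom _ _ fun a b h => by simpa using h)
    (finite_support_mul_gaussBinom _ _ fun a b h => by simpa using h)
    (Equiv.neg ℤ) (Equiv.subLeft (-1)), mul_finsum]
  refine finsum_congr fun j => ?_
  simp only [Equiv.neg_apply, Equiv.subLeft_apply]
  rw [← gaussBinom_symm (2 * t) (t - 3 * -j), ← gaussBinom_symm (2 * t) (t - 3 * (-1 - j) - 2)]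
  have h1 : ((2 * t : ℕ) : ℤ) - (t - 3 * -j) = t - 3 * j := by push_cast; ring
  have h2 : ((2 * t : ℕ) : ℤ) - (t - 3 * (-1 - j) - 2) = t - 3 * j - 1 := by push_cast; ring
  have h3 : (T (-(3 * (-j) ^ 2 - -j + t)) : ℤ[T;T⁻¹]) = T (-t) * T (-(3 * j ^ 2 + j)) := by
    rw [← T_add]; congr 1; ring
  have h4 : (T (-(3 * (-1 - j) ^ 2 + 5 * (-1 - j) + 2 + t)) : ℤ[T;T⁻¹]) =
      T (-t) * T (-(3 * j ^ 2 + j)) := by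
    rw [← T_add]; congr 1; ring
  rw [h1, h2, h3, h4]
  ring

theorem pentagonalEven_succ (t : ℕ) :
    pentagonalEven (t + 1) = T (-((t : ℤ) + 1)) * pentagonalOdd t := by
  unfold pentagonalOdd pentagonalEven
  have hsplit : ∀ j : ℤ, T (-(3 * j ^ 2 + j)) *
      (gaussBinom (2 * (t + 1)) ((t + 1 : ℕ) - 3 * j) -
        gaussBinom (2 * (t + 1)) ((t + 1 : ℕ) - 3 * j - 1)) =
      T (-(3 * j ^ 2 - 2 * j + t + 1)) * gaussBinom (2 * t + 1) (t + 1 - 3 * j) -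
      T (-(3 * j ^ 2 + 4 * j + 2 + t)) * gaussBinom (2 * t + 1) (t - 3 * j - 1) := by
    intro j
    have e0 : 2 * (t + 1) = 2 * t + 1 + 1 := by ring
    have e1 : ((t + 1 : ℕ) : ℤ) - 3 * j - 1 = t - 3 * j := by push_cast; ring
    rw [e0, gaussBinom_succ, e1, gaussBinom_succ' (2 * t + 1) (t - 3 * j)]
    have h1 : (T (-(3 * j ^ 2 - 2 * j + t + 1)) : ℤ[T;T⁻¹]) =
        T (-(3 * j ^ 2 + j)) * T (-((t + 1 : ℕ) - 3 * j)) := by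
      rw [← T_add]; congr 1; push_cast; ring
    have h2 : (T (-(3 * j ^ 2 + 4 * j + 2 + t)) : ℤ[T;T⁻¹]) =
        T (-(3 * j ^ 2 + j)) * T ((t : ℤ) - 3 * j - (2 * t + 1 : ℕ) - 1) := by
      rw [← T_add]; congr 1; push_cast; ring
    rw [h1, h2]
    push_cast
    ring
  rw [finsum_congr hsplit, finsum_sub_reindex
    (finite_support_mul_gaussBinom _ _ fun a b h => by simpa using h)
    (finite_support_mul_gaussBinom _ _ fun a b h => by simpa using h)
    (Equiv.neg ℤ) (Equiv.subLeft (-1)), mul_finsum]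
  refine finsum_congr fun j => ?_
  simp only [Equiv.neg_apply, Equiv.subLeft_apply]
  rw [← gaussBinom_symm (2 * t + 1) (t + 1 - 3 * -j),
    ← gaussBinom_symm (2 * t + 1) (t - 3 * (-1 - j) - 1)]
  have h1 : ((2 * t + 1 : ℕ) : ℤ) - (t + 1 - 3 * -j) = t - 3 * j := by push_cast; ring
  have h2 : ((2 * t + 1 : ℕ) : ℤ) - (t - 3 * (-1 - j) - 1) = t - 3 * j - 1 := by push_cast; ring
  have h3 : (T (-(3 * (-j) ^ 2 - 2 * -j + t + 1)) : ℤ[T;T⁻¹]) =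
      T (-(t + 1)) * T (-(3 * j ^ 2 + 2 * j)) := by
    rw [← T_add]; congr 1; ring
  have h4 : (T (-(3 * (-1 - j) ^ 2 + 4 * (-1 - j) + 2 + t)) : ℤ[T;T⁻¹]) =
      T (-(t + 1)) * T (-(3 * j ^ 2 + 2 * j)) := by
    rw [← T_add]; congr 1; ring
  rw [h1, h2, h3, h4]
  ring

theorem pentagonalEven_eq (t : ℕ) : pentagonalEven t = T (-(t : ℤ) ^ 2) := by
  induction t with
  | zero =>
    unfold pentagonalEven
    rw [finsum_eq_single _ (0 : ℤ)]
    · simp [gaussBinom]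
    · intro j hj
      have h1 : -(3 * j) ≠ 0 := by omega
      have h2 : -(3 * j) - 1 ≠ 0 := by omega
      simp [gaussBinom, h2, hj]
  | succ t ih =>
    rw [pentagonalEven_succ, pentagonalOdd_eq, ih, ← T_add, ← T_add]
    congr 1; push_cast; ring

theorem pentagonalOdd_eq_T (t : ℕ) : pentagonalOdd t = T (-((t : ℤ) ^ 2 + t)) := by
  rw [pentagonalOdd_eq, pentagonalEven_eq, ← T_add]
  congr 1; ring

/-! ### The rank-weighted functional -/

/-- The functional sending `g` to the sum of `g (rank A)` over the strictly upper-triangular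
`N × N` matrices `A` of square zero, with the field size `q` as a formal parameter. -/
def rankFunctional {R : Type*} [CommRing R] (q : R) : ℕ → (ℕ → R) →ₗ[R] R
  | 0 => LinearMap.proj 0
  | N + 1 => rankFunctional q N ∘ₗ LinearMap.pi fun r =>
      q ^ r • LinearMap.proj r + (q ^ (N - r) - q ^ r) • LinearMap.proj (r + 1)

section rankFunctional
variable {R : Type*} [CommRing R] (q : R)

theorem rankFunctional_zero (g : ℕ → R) : rankFunctional q 0 g = g 0 := rfl

theorem rankFunctional_succ (N : ℕ) (g : ℕ → R) :
    rankFunctional q (N + 1) g =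
      rankFunctional q N fun r => q ^ r * g r + (q ^ (N - r) - q ^ r) * g (r + 1) := rfl

theorem map_rankFunctional {S : Type*} [CommRing S] (φ : R →+* S) (N : ℕ) (g : ℕ → R) :
    φ (rankFunctional q N g) = rankFunctional (φ q) N fun r => φ (g r) := by
  induction N generalizing g with
  | zero => rfl
  | succ N ih => simp [rankFunctional_succ, ih]

theorem rankFunctional_congr {N : ℕ} {g h : ℕ → R} (H : ∀ r, 2 * r ≤ N → g r = h r) :
    rankFunctional q N g = rankFunctional q N h := by
  induction N generalizing g h with
  | zero => exact H 0 le_rfl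
  | succ N ih =>
    rw [rankFunctional_succ, rankFunctional_succ]
    refine ih fun r hr => ?_
    rw [H r (by omega)]
    rcases hr.lt_or_eq with h' | h'
    · rw [H (r + 1) (by omega)]
    · have : N - r = r := by omega
      simp [this]

end rankFunctional

theorem binomZ_succ (m : ℕ) (k : ℤ) : binomZ (m + 1) k = binomZ m k + binomZ m (k - 1) := by
  rcases lt_trichotomy k 0 with h | rfl | h
  · rw [binomZ_of_neg h, binomZ_of_neg h, binomZ_of_neg (by omega), add_zero]
  · simp [binomZ]
  · obtain ⟨l, rfl⟩ : ∃ l : ℕ, k = l + 1 := ⟨(k - 1).toNat, by omega⟩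
    have h1 : ((l : ℤ) + 1).toNat = l + 1 := by omega
    have h2 : (0 : ℤ) ≤ l + 1 := by omega
    simp [binomZ, h1, h2, Nat.choose_succ_succ, add_comm]

/-- One step of the functional turns the test function for `(N + 1, i)` into the sum of those for
`(N, i)` and `(N, i - 1)`, matching Pascal's rule for `binomZ`. -/
theorem rankFunctional_gaussBinom (N : ℕ) (i : ℤ) :
    rankFunctional (T 1 : ℤ[T;T⁻¹]) N
      (fun r => T (-((r : ℤ) * (N - r))) * gaussBinom (N - 2 * r) (i - r)) =
      LaurentPolynomial.C (binomZ N i) := by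
  induction N generalizing i with
  | zero =>
    rw [rankFunctional_zero]
    rcases lt_trichotomy i 0 with h | rfl | h
    · simp [binomZ_of_neg h, gaussBinom, h.ne]
    · simp [binomZ, gaussBinom]
    · rw [binomZ_of_lt (by simpa using h)]
      simp [gaussBinom, h.ne']
  | succ N ih =>
    rw [binomZ_succ, map_add, ← ih i, ← ih (i - 1), ← map_add, rankFunctional_succ]
    refine rankFunctional_congr _ fun r hr => ?_
    obtain ⟨s, rfl⟩ : ∃ s, N = 2 * r + s := ⟨N - 2 * r, by omega⟩
    have e1 : 2 * r + s + 1 - 2 * r = s + 1 := by omega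
    have e2 : 2 * r + s - 2 * r = s := by omega
    have e3 : 2 * r + s - r = r + s := by omega
    have e4 : i - 1 - (r : ℤ) = i - r - 1 := by ring
    have e5 : i - ((r + 1 : ℕ) : ℤ) = i - r - 1 := by push_cast; ring
    simp only [Pi.add_apply, LaurentPolynomial.T_pow, mul_one, e1, e2, e3, e4, e5]
    have h1 : (T r * T (-((r : ℤ) * ((2 * r + s + 1 : ℕ) - r))) : ℤ[T;T⁻¹]) =
        T (-((r : ℤ) * ((2 * r + s : ℕ) - r))) := by
      rw [← T_add]; congr 1; push_cast; ring
    have h2 : (T ((r + s : ℕ) : ℤ) *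
        T (-(((r + 1 : ℕ) : ℤ) * ((2 * r + s + 1 : ℕ) - (r + 1 : ℕ)))) : ℤ[T;T⁻¹]) =
        T (-((r : ℤ) * ((2 * r + s : ℕ) - r))) := by
      rw [← T_add]; congr 1; push_cast; ring
    have h3 : (T r * T (-(((r + 1 : ℕ) : ℤ) * ((2 * r + s + 1 : ℕ) - (r + 1 : ℕ)))) : ℤ[T;T⁻¹]) =
        T (-((r : ℤ) * ((2 * r + s : ℕ) - r))) * T (-(s : ℤ)) := by
      rw [← T_add, ← T_add]; congr 1; push_cast; ring
    cases s with
    | zero =>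
      have key : gaussBinom 1 (i - r) = gaussBinom 0 (i - r) + gaussBinom 0 (i - r - 1) := by
        have := gaussBinom_succ' 0 (i - r)
        rw [this]
        rcases eq_or_ne (i - r : ℤ) 1 with h | h
        · simp [h]
        · have : i - r - 1 ≠ (0 : ℤ) := by omega
          simp [gaussBinom, this]
      -- The upper index would be `-1` and is truncated to `0`; this is harmless, since its weight
      -- `q^r - q^r` is zero.
      have e6 : 2 * r + 0 + 1 - 2 * (r + 1) = 0 := by omega
      rw [e6]
      simp only [add_zero, Nat.cast_zero, neg_zero, T_zero, zero_add] at *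
      linear_combination gaussBinom 1 (i - r) * h1 + (h2 - h3) * gaussBinom 0 (i - r - 1) +
        T (-((r : ℤ) * ((2 * r : ℕ) - r))) * key
    | succ s =>
      have e6 : 2 * r + (s + 1) + 1 - 2 * (r + 1) = s := by omega
      rw [e6]
      have key := gaussBinom_three_term s (i - r)
      have hs : ((s + 1 : ℕ) : ℤ) = s + 1 := by push_cast; ring
      rw [hs] at h3
      linear_combination gaussBinom (s + 2) (i - r) * h1 + (h2 - h3) * gaussBinom s (i - r - 1) +
        T (-((r : ℤ) * ((2 * r + (s + 1) : ℕ) - r))) * key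

/-! ### Counting matrices by rank -/

section Counting
variable {F : Type*} [Field F] {N : ℕ}

/-- The `(N + 1) × (N + 1)` matrix with zero first column, first row `(0, w)`, and remaining
block `A`. -/
def borderRow (A : Matrix (Fin N) (Fin N) F) (w : Fin N → F) :
    Matrix (Fin (N + 1)) (Fin (N + 1)) F :=
  Matrix.of (Fin.cons (Fin.cons 0 w) fun i => Fin.cons 0 (A i))

@[simp] theorem borderRow_apply_zero (A : Matrix (Fin N) (Fin N) F) (w : Fin N → F)
    (i : Fin (N + 1)) : borderRow A w i 0 = 0 := by
  refine Fin.cases ?_ (fun i => ?_) i <;> rfl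

@[simp] theorem borderRow_zero_succ (A : Matrix (Fin N) (Fin N) F) (w : Fin N → F)
    (j : Fin N) : borderRow A w 0 j.succ = w j := rfl

@[simp] theorem borderRow_succ_succ (A : Matrix (Fin N) (Fin N) F) (w : Fin N → F)
    (i j : Fin N) : borderRow A w i.succ j.succ = A i j := rfl

theorem borderRow_sq_eq_zero_iff (A : Matrix (Fin N) (Fin N) F) (w : Fin N → F) :
    borderRow A w ^ 2 = 0 ↔ A ^ 2 = 0 ∧ Matrix.vecMul w A = 0 := by
  simp only [← Matrix.ext_iff, funext_iff, sq, Matrix.mul_apply, Fin.sum_univ_succ,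
    Fin.forall_fin_succ, Matrix.vecMul, dotProduct]
  simp [and_comm]

theorem borderRow_isUpperTriangular_iff (A : Matrix (Fin N) (Fin N) F) (w : Fin N → F) :
    (borderRow A w).IsUpperTriangular ↔ A.IsUpperTriangular := by
  constructor
  · intro h i j hij
    exact h (i := i.succ) (j := j.succ) (Fin.succ_lt_succ_iff.mpr hij)
  · intro h i j hij
    induction j using Fin.cases with
    | zero => simp
    | succ j =>
      induction i using Fin.cases with
      | zero => exact absurd hij (Fin.not_lt_zero _)
      | succ i => exact h (Fin.succ_lt_succ_iff.mp hij)

variable (F N) in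
/-- The upper-triangular `N × N` matrices of square zero. -/
abbrev SquareZeroUT : Type _ :=
  {A : Matrix (Fin N) (Fin N) F // A.IsUpperTriangular ∧ A ^ 2 = 0}

theorem borderRow_submatrix_succ {B : Matrix (Fin (N + 1)) (Fin (N + 1)) F}
    (h : B.IsUpperTriangular) (h2 : B ^ 2 = 0) :
    borderRow (B.submatrix Fin.succ Fin.succ) (fun j => B 0 j.succ) = B := by
  have hcol : ∀ i : Fin N, B i.succ 0 = 0 := fun i => h (Fin.succ_pos i)
  -- The rest of the first column is zero, so the corner of `B ^ 2` is the square of `B 0 0`.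
  have h00 : B 0 0 = 0 := by
    have := congrFun (congrFun h2 0) 0
    simpa [sq, Matrix.mul_apply, Fin.sum_univ_succ, hcol] using this
  ext i j
  induction j using Fin.cases with
  | zero =>
    induction i using Fin.cases with
    | zero => simp [h00]
    | succ i => simp [hcol]
  | succ j => induction i using Fin.cases <;> rfl

variable (F N) in
/-- A square-zero upper-triangular matrix of size `N + 1` is one of size `N` together with a
vector of its left kernel. -/
def squareZeroUTSuccEquiv :
    (Σ A : SquareZeroUT F N, LinearMap.ker A.1.vecMulLinear) ≃ SquareZeroUT F (N + 1) where
  toFun p := ⟨borderRow p.1.1 p.2.1, (borderRow_isUpperTriangular_iff _ _).mpr p.1.2.1,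
    (borderRow_sq_eq_zero_iff _ _).mpr ⟨p.1.2.2, p.2.2⟩⟩
  invFun B :=
    have hB := borderRow_submatrix_succ B.2.1 B.2.2
    have hB2 := (borderRow_sq_eq_zero_iff _ _).mp (hB.symm ▸ B.2.2)
    ⟨⟨B.1.submatrix Fin.succ Fin.succ,
      (borderRow_isUpperTriangular_iff _ _).mp (hB.symm ▸ B.2.1), hB2.1⟩,
      ⟨fun j => B.1 0 j.succ, hB2.2⟩⟩
  left_inv _ := rfl
  right_inv B := Subtype.ext (borderRow_submatrix_succ B.2.1 B.2.2)

/-- Prepending a zero coordinate. -/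
def consZero : (Fin N → F) →ₗ[F] (Fin (N + 1) → F) where
  toFun v := Fin.cons 0 v
  map_add' v w := by
    ext i; induction i using Fin.cases <;> simp
  map_smul' c v := by
    ext i; induction i using Fin.cases <;> simp

theorem consZero_injective : Function.Injective (consZero : (Fin N → F) →ₗ[F] _) :=
  fun _ _ h => (Fin.cons_injective2 (α := fun _ => F) h).2

theorem rank_borderRow (A : Matrix (Fin N) (Fin N) F) (w : Fin N → F) :
    (borderRow A w).rank =
      Module.finrank F ↥(LinearMap.range A.vecMulLinear ⊔ Submodule.span F {w}) := by
  have hrow : Set.range (borderRow A w).row = consZero '' (Set.range A.row ∪ {w}) := by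
    rw [Set.image_union, Set.image_singleton, ← Set.range_comp]
    change Set.range (Fin.cons (Fin.cons 0 w) (fun i => Fin.cons 0 (A i)) :
      Fin (N + 1) → Fin (N + 1) → F) = _
    rw [Fin.range_cons, Set.union_singleton]
    rfl
  rw [Matrix.rank_eq_finrank_span_row, hrow, Submodule.span_image, Submodule.span_union,
    (Submodule.equivMapOfInjective _ consZero_injective _).finrank_eq.symm, range_vecMulLinear]

theorem rank_eq_finrank_range_vecMulLinear (A : Matrix (Fin N) (Fin N) F) :
    A.rank = Module.finrank F (LinearMap.range A.vecMulLinear) := by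
  rw [Matrix.rank_eq_finrank_span_row, range_vecMulLinear]

open Classical in
theorem sum_rank_borderRow [Fintype F] {R : Type*} [CommRing R] (A : Matrix (Fin N) (Fin N) F)
    (hA : A ^ 2 = 0) (g : ℕ → R) :
    ∑ w : LinearMap.ker A.vecMulLinear, g (borderRow A w.1).rank =
      (Fintype.card F : R) ^ A.rank * g A.rank +
        ((Fintype.card F : R) ^ (N - A.rank) - (Fintype.card F : R) ^ A.rank) *
          g (A.rank + 1) := by
  set K := LinearMap.ker A.vecMulLinear
  set I := LinearMap.range A.vecMulLinear
  -- `A ^ 2 = 0` enters here: it makes the count of `w` outside the row space a difference of two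
  -- powers.
  have hIK : I ≤ K := by
    rintro _ ⟨v, rfl⟩
    simp [K, Matrix.vecMul_vecMul, ← sq, hA]
  have hrank : ∀ w : K, g (borderRow A w.1).rank =
      if w.1 ∈ I then g A.rank else g (A.rank + 1) := by
    intro w
    rw [rank_borderRow, rank_eq_finrank_range_vecMulLinear]
    split_ifs with h
    · rw [sup_eq_left.mpr ((Submodule.span_singleton_le_iff_mem _ _).mpr h)]
    · rw [Submodule.finrank_sup_span_singleton h]
  have hcardI : Fintype.card {w : K // w.1 ∈ I} = Fintype.card F ^ A.rank := by
    rw [Fintype.card_congr (Equiv.subtypeSubtypeEquivSubtype (p := (· ∈ K)) (q := (· ∈ I))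
      fun h => hIK h)]
    rw [rank_eq_finrank_range_vecMulLinear]
    exact Module.card_eq_pow_finrank (K := F) (V := I)
  have hcardK : Fintype.card K = Fintype.card F ^ (N - A.rank) := by
    rw [Module.card_eq_pow_finrank (K := F), rank_eq_finrank_range_vecMulLinear]
    congr 1
    have := A.vecMulLinear.finrank_range_add_finrank_ker
    simp only [Module.finrank_fin_fun] at this
    change Module.finrank F K = N - Module.finrank F I
    change Module.finrank F I + Module.finrank F K = N at this
    omega
  have hsplit := Finset.card_filter_add_card_filter_not (s := (Finset.univ : Finset K))
    (fun w => w.1 ∈ I)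
  rw [← Fintype.card_subtype, hcardI, Finset.card_univ, hcardK] at hsplit
  have hsplit' := congrArg (Nat.cast : ℕ → R) hsplit
  push_cast at hsplit'
  rw [Finset.sum_congr rfl fun w _ => hrank w, Finset.sum_ite, Finset.sum_const, Finset.sum_const,
    ← Fintype.card_subtype, hcardI, nsmul_eq_mul, nsmul_eq_mul, ← hsplit']
  push_cast
  ring

open Classical in
theorem sum_rank_squareZeroUT [Fintype F] {R : Type*} [CommRing R] (N : ℕ) (g : ℕ → R) :
    ∑ A : SquareZeroUT F N, g A.1.rank = rankFunctional (Fintype.card F : R) N g := by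
  induction N generalizing g with
  | zero =>
    rw [rankFunctional_zero]
    have : Unique (SquareZeroUT F 0) :=
      ⟨⟨⟨0, Matrix.blockTriangular_zero, by simp⟩⟩, fun A => Subsingleton.elim _ _⟩
    rw [Fintype.sum_unique]
    congr 1
    exact Nat.le_zero.mp (Matrix.rank_le_width _)
  | succ N ih =>
    rw [rankFunctional_succ, ← ih, ← (squareZeroUTSuccEquiv F N).sum_comp, Fintype.sum_sigma]
    exact Finset.sum_congr rfl fun A _ => sum_rank_borderRow A.1 A.2.2 g

end Counting

theorem numSquareZero_eq_rankFunctional (F : Type*) [Field F] [Finite F] (N : ℕ) :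
    (numSquareZero F N : ℤ) = rankFunctional (Nat.card F : ℤ) N 1 := by
  classical
  have := Fintype.ofFinite F
  rw [Nat.card_eq_fintype_card (α := F)]
  have h := sum_rank_squareZeroUT (F := F) (R := ℤ) N 1
  rw [← h, numSquareZero, Nat.card_eq_fintype_card]
  simp

/-! ### The closed forms -/

theorem finsum_coeffKM_eq_rankFunctional (m : ℕ) (k : ℤ) (e d : ℤ → ℤ) (c : ℤ)
    (he : ∀ j, e j = c - d j) :
    ∑ᶠ j : ℤ, LaurentPolynomial.C (coeffKM m k j) * (T (e j) : ℤ[T;T⁻¹]) =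
      rankFunctional (T 1 : ℤ[T;T⁻¹]) m fun r => T (c - r * (m - r)) *
        ∑ᶠ j : ℤ, (T (-d j) : ℤ[T;T⁻¹]) *
          (gaussBinom (m - 2 * r) (k - r - 3 * j) - gaussBinom (m - 2 * r) (k - r - 3 * j - 1)) := by
  -- One window containing all contributing `j`, uniformly in `r`, so that the sum commutes with the
  -- functional.
  set J := Finset.Icc (-(m : ℤ) - |k| - 1) (|k| + 1)
  have hk := le_abs_self k
  have hk' := neg_abs_le k
  have hL : ∑ᶠ j : ℤ, LaurentPolynomial.C (coeffKM m k j) * (T (e j) : ℤ[T;T⁻¹]) =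
      ∑ j ∈ J, LaurentPolynomial.C (coeffKM m k j) * T (e j) := by
    refine finsum_eq_sum_of_support_subset _ fun j hj => ?_
    by_contra h
    apply hj
    simp only [J, Finset.coe_Icc, Set.mem_Icc, not_and_or, not_le] at h
    have h0 : coeffKM m k j = 0 := by
      unfold coeffKM
      rcases h with h | h
      · rw [binomZ_of_lt (by omega), binomZ_of_lt (by omega), sub_zero]
      · rw [binomZ_of_neg (by omega), binomZ_of_neg (by omega), sub_zero]
    simp [h0]
  have hR : ∀ r : ℕ, 2 * r ≤ m → ∑ᶠ j : ℤ, (T (-d j) : ℤ[T;T⁻¹]) *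
      (gaussBinom (m - 2 * r) (k - r - 3 * j) - gaussBinom (m - 2 * r) (k - r - 3 * j - 1)) =
      ∑ j ∈ J, (T (-d j) : ℤ[T;T⁻¹]) *
      (gaussBinom (m - 2 * r) (k - r - 3 * j) - gaussBinom (m - 2 * r) (k - r - 3 * j - 1)) := by
    intro r hr
    refine finsum_eq_sum_of_support_subset _ fun j hj => ?_
    by_contra h
    apply hj
    simp only [J, Finset.coe_Icc, Set.mem_Icc, not_and_or, not_le] at h
    simp only
    rw [gaussBinom_of_notMem _ _ (by simp only [Set.mem_Icc]; omega),
      gaussBinom_of_notMem _ _ (by simp only [Set.mem_Icc]; omega), sub_zero, mul_zero]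
  have hterm : ∀ j ∈ J, LaurentPolynomial.C (coeffKM m k j) * (T (e j) : ℤ[T;T⁻¹]) =
      rankFunctional (T 1 : ℤ[T;T⁻¹]) m ((T (e j) : ℤ[T;T⁻¹]) •
        ((fun r : ℕ => T (-((r : ℤ) * (m - r))) * gaussBinom (m - 2 * r) (k - 3 * j - r)) -
          fun r : ℕ => T (-((r : ℤ) * (m - r))) *
            gaussBinom (m - 2 * r) (k - 3 * j - 1 - r))) := by
    intro j _
    rw [map_smul, map_sub, rankFunctional_gaussBinom, rankFunctional_gaussBinom, ← map_sub,
      smul_eq_mul, mul_comm, coeffKM]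
  rw [hL, Finset.sum_congr rfl hterm, ← map_sum]
  refine rankFunctional_congr _ fun r hr => ?_
  rw [hR r hr, Finset.sum_apply, Finset.mul_sum]
  refine Finset.sum_congr rfl fun j _ => ?_
  have h1 : (T (e j) * T (-((r : ℤ) * (m - r))) : ℤ[T;T⁻¹]) = T (c - r * (m - r)) * T (-d j) := by
    rw [← T_add, ← T_add, he]; congr 1; ring
  have h2 : k - 3 * j - r = k - r - 3 * j := by ring
  have h3 : k - 3 * j - 1 - r = k - r - 3 * j - 1 := by ring
  simp only [Pi.smul_apply, Pi.sub_apply, smul_eq_mul, h2, h3]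
  linear_combination h1 *
    (gaussBinom (m - 2 * r) (k - r - 3 * j) - gaussBinom (m - 2 * r) (k - r - 3 * j - 1))

/-- The prefactor exponent is `n² - r(2n - r) = (n - r)²`, exactly opposite to that of
`pentagonalEven (n - r)`. -/
theorem evenSum_eq_rankFunctional (n : ℕ) :
    evenSum n = rankFunctional (T 1 : ℤ[T;T⁻¹]) (2 * n) 1 := by
  rw [evenSum, finsum_coeffKM_eq_rankFunctional (2 * n) n _ (fun j => 3 * j ^ 2 + j)
    ((n : ℤ) ^ 2) fun j => by ring]
  refine rankFunctional_congr _ fun r hr => ?_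
  obtain ⟨t, rfl⟩ : ∃ t, n = r + t := ⟨n - r, by omega⟩
  have h1 : 2 * (r + t) - 2 * r = 2 * t := by omega
  have h2 : ((r + t : ℕ) : ℤ) - r = t := by push_cast; ring
  have h := pentagonalEven_eq t
  rw [pentagonalEven] at h
  rw [h1, h2, h, ← T_add, Pi.one_apply, ← T_zero]
  congr 1; push_cast; ring

/-- Here the cancelling exponent is `n² + n - r(2n + 1 - r) = (n - r)² + (n - r)`. -/
theorem oddSum_eq_rankFunctional (n : ℕ) :
    oddSum n = rankFunctional (T 1 : ℤ[T;T⁻¹]) (2 * n + 1) 1 := by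
  rw [oddSum, finsum_coeffKM_eq_rankFunctional (2 * n + 1) n _ (fun j => 3 * j ^ 2 + 2 * j)
    ((n : ℤ) ^ 2 + n) fun j => by ring]
  refine rankFunctional_congr _ fun r hr => ?_
  obtain ⟨t, rfl⟩ : ∃ t, n = r + t := ⟨n - r, by omega⟩
  have h1 : 2 * (r + t) + 1 - 2 * r = 2 * t + 1 := by omega
  have h2 : ((r + t : ℕ) : ℤ) - r = t := by push_cast; ring
  have h := pentagonalOdd_eq_T t
  rw [pentagonalOdd] at h
  rw [h1, h2, h, ← T_add, Pi.one_apply, ← T_zero]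
  congr 1; push_cast; ring

theorem toLaurent_rankFunctional (N : ℕ) :
    Polynomial.toLaurent (rankFunctional (Polynomial.X : ℤ[X]) N 1) =
      rankFunctional (T 1 : ℤ[T;T⁻¹]) N 1 := by
  rw [map_rankFunctional, Polynomial.toLaurent_X]
  simp only [Pi.one_apply, map_one]
  rfl

theorem mainTheorem1 :
    ∃ C : ℕ → ℤ[X],
      (∀ n : ℕ, Polynomial.toLaurent (C (2 * n)) = evenSum n) ∧
      (∀ n : ℕ, Polynomial.toLaurent (C (2 * n + 1)) = oddSum n) ∧
      ∀ (F : Type*) [Field F] [Finite F] (N : ℕ),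
        (numSquareZero F N : ℤ) = (C N).eval (Nat.card F : ℤ) := by
  -- Running the rank recursion over `ℤ[X]` makes polynomiality automatic; ring homomorphisms carry
  -- it to Laurent polynomials and to values at `q`.
  refine ⟨fun N => rankFunctional Polynomial.X N 1, fun n => ?_, fun n => ?_, fun F _ _ N => ?_⟩
  · rw [toLaurent_rankFunctional, evenSum_eq_rankFunctional]
  · rw [toLaurent_rankFunctional, oddSum_eq_rankFunctional]
  · rw [numSquareZero_eq_rankFunctional, ← Polynomial.coe_evalRingHom, map_rankFunctional]
    simp only [Polynomial.coe_evalRingHom, Polynomial.eval_X, Pi.one_apply, Polynomial.eval_one]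
    rfl
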